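/- All rings are associative with $1$, not necessarily commutative; homomorphisms preserve $1$; $\mathrm U(B)$ is the group of units of $B$. For a ring $A$ and $S\subseteq A$, let $i_S:A\to A_S$ be the universal homomorphism making all elements of $S$ invertible; write $A_a=A_{\{a\}}$. *Full spectrum.* A homomorphism $\varphi:A\to B$ to a nonzero ring defines a sequence $\mathcal S=(S_1,S_2,\dots)$: put $A_0=A$, $\varphi_0=\varphi$, $S_{n+1}=\varphi_n^{-1}(\mathrm U(B))\subseteq A_n$, $A_{n+1}=(A_n)_{S_{n+1}}$, and let $\varphi_{n+1}:A_{n+1}\to B$ be the extension of $\varphi_n$. The sequences $\mathcal S$ arising in this way are the fully invertible systems on $A$; $\mathrm F(A)$ is the set of all of them, and $A_{\mathcal S}=\varinjlim_n A_n$. A fraction of $A$ is a tuple $\mathbf a=(a_1,\dots,a_n)$ with $a_1\in A$, $a_2\in A_{a_1}$, $a_3\in (A_{a_1})_{a_2}$, and so on; $D(\mathbf a)\subseteq \mathrm F(A)$ is the set of those $\mathcal S$ for which $a_1,\dots,a_n$ successively become invertible in $A_{\mathcal S}$. The sets $D(\mathbf a)$ are a base of the topology of $\mathrm F(A)$, and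 are called its fundamental open subsets. The structure sheaf $\mathcal O_A$ assigns to an open $U$ the ring of all functions $t$ on $U$ with $t(\mathcal S)\in A_{\mathcal S}$ that are locally given by one expression built from finitely many elements of $A$ by sums, products and inverses, each element that the expression inverts being invertible in $A_{\mathcal S}$ for all $\mathcal S$ of the neighbourhood. *F-schemes.* An affine F-scheme is a ringed space (with a sheaf of not necessarily commutative rings) isomorphic to $(\mathrm F(A),\mathcal O_A)$ for some nonzero ring $A$. An F-scheme is a ringed space in which every point has an open neighbourhood that, with the restricted sheaf, is an affine F-scheme. A center of a topological space is a closed point that lies in every nonempty closed subset. **Lemma.** (1) An F-scheme is affine if and only if its underlying space has a center. (2) Let $A$ be a nonzero ring, $X$ a ringed space, $e:X\to \mathrm F(A)$ an isomorphism of ringed spaces and $U\subseteq X$ open. Then the open ringed subspace $(U,\mathcal O_X|_U)$ is an affine F-scheme if and only if $U$ is nonempty and $U=e^{-1}(D(\mathbf a))$ for some fraction $\mathbf a$ of $A$. That is, the open affine sub-F-schemes of an affine F-scheme are exactly its nonempty fundamental open subsets. -/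

import Mathlib

open CategoryTheory CategoryTheory.Limits TopologicalSpace Opposite AlgebraicGeometry

universe u

noncomputable section

namespace FScheme

/-! ### Localization of a noncommutative ring at a subset -/

section Localization

variable (A : Type u) [Ring A] (S : Set A)

/-- The relations of the presentation `⟨A, x_s (s ∈ S) | x_s s = s x_s = 1⟩`: those which make
`A` a subring of coefficients, and those which make `x_s` an inverse of `s`. -/
inductive LocRel : FreeAlgebra ℤ (A ⊕ S) → FreeAlgebra ℤ (A ⊕ S) → Prop
  | map_one : LocRel (FreeAlgebra.ι ℤ (Sum.inl 1)) 1
  | map_add (a b : A) : LocRel (FreeAlgebra.ι ℤ (Sum.inl (a + b)))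
      (FreeAlgebra.ι ℤ (Sum.inl a) + FreeAlgebra.ι ℤ (Sum.inl b))
  | map_mul (a b : A) : LocRel (FreeAlgebra.ι ℤ (Sum.inl (a * b)))
      (FreeAlgebra.ι ℤ (Sum.inl a) * FreeAlgebra.ι ℤ (Sum.inl b))
  | mul_inv (s : S) : LocRel
      (FreeAlgebra.ι ℤ (Sum.inl (s : A)) * FreeAlgebra.ι ℤ (Sum.inr s)) 1
  | inv_mul (s : S) : LocRel
      (FreeAlgebra.ι ℤ (Sum.inr s) * FreeAlgebra.ι ℤ (Sum.inl (s : A))) 1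

/-- The localization `A_S`. -/
def Loc : Type u := RingQuot (LocRel A S)

instance : Ring (Loc A S) := inferInstanceAs (Ring (RingQuot (LocRel A S)))

/-- The canonical homomorphism `i_S : A → A_S`. -/
def Loc.of : A →+* Loc A S :=
  RingHom.mk'
    { toFun := fun a => RingQuot.mkRingHom (LocRel A S) (FreeAlgebra.ι ℤ (Sum.inl a))
      map_one' := (RingQuot.mkRingHom_rel LocRel.map_one).trans (map_one _)
      map_mul' := fun a b => (RingQuot.mkRingHom_rel (LocRel.map_mul a b)).trans (map_mul _ _ _) }
    (fun a b => (RingQuot.mkRingHom_rel (LocRel.map_add a b)).trans (map_add _ _ _))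

variable {A S}

theorem Loc.isUnit_of {s : A} (hs : s ∈ S) : IsUnit (Loc.of A S s) := by
  refine ⟨⟨Loc.of A S s,
    RingQuot.mkRingHom (LocRel A S) (FreeAlgebra.ι ℤ (Sum.inr ⟨s, hs⟩)), ?_, ?_⟩, rfl⟩
  · exact ((map_mul _ _ _).symm.trans
      (RingQuot.mkRingHom_rel (LocRel.mul_inv (⟨s, hs⟩ : S)))).trans (map_one _)
  · exact ((map_mul _ _ _).symm.trans
      (RingQuot.mkRingHom_rel (LocRel.inv_mul (⟨s, hs⟩ : S)))).trans (map_one _)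

variable {B : Type u} [Ring B]

/-- The homomorphism `A_S → B` induced by a homomorphism `φ : A → B` with `φ(S) ⊆ U(B)`. -/
def Loc.lift (φ : A →+* B) (h : ∀ s ∈ S, IsUnit (φ s)) : Loc A S →+* B :=
  RingQuot.lift
    ⟨(FreeAlgebra.lift ℤ
        (Sum.elim (fun a => φ a) fun s : S => ((h s s.2).unit⁻¹ : Bˣ)) :
          FreeAlgebra ℤ (A ⊕ S) →ₐ[ℤ] B).toRingHom, by
      intro x y r
      cases r <;> simp⟩

@[simp]
theorem Loc.lift_of (φ : A →+* B) (h : ∀ s ∈ S, IsUnit (φ s)) (a : A) :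
    Loc.lift φ h (Loc.of A S a) = φ a := by
  refine (RingQuot.lift_mkRingHom_apply _ _ _).trans ?_
  simp

/-- Uniqueness in the universal property of `A_S`. -/
theorem Loc.hom_ext {f g : Loc A S →+* B}
    (h : f.comp (Loc.of A S) = g.comp (Loc.of A S)) : f = g := by
  have key : ∀ a, f (Loc.of A S a) = g (Loc.of A S a) := fun a => congrArg (fun k : A →+* B => k a) h
  refine RingQuot.ringQuot_ext (r := LocRel A S) f g ?_
  have : ((f.comp (RingQuot.mkRingHom (LocRel A S)) : FreeAlgebra ℤ (A ⊕ S) →+* B).toIntAlgHom) = (g.comp (RingQuot.mkRingHom (LocRel A S)) : FreeAlgebra ℤ (A ⊕ S) →+* B).toIntAlgHom := by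
    apply FreeAlgebra.hom_ext
    funext x
    rcases x with a | s
    · exact key a
    · have h1 : ∀ k : Loc A S →+* B, k (Loc.of A S s) * k (RingQuot.mkRingHom (LocRel A S) (FreeAlgebra.ι ℤ (Sum.inr s))) = 1 := by
        intro k
        refine (map_mul k _ _).symm.trans ?_
        refine (congrArg k ((map_mul (RingQuot.mkRingHom (LocRel A S)) _ _).symm.trans ((RingQuot.mkRingHom_rel (LocRel.mul_inv s)).trans (map_one _)))).trans (map_one k)
      have h2 : ∀ k : Loc A S →+* B, k (RingQuot.mkRingHom (LocRel A S) (FreeAlgebra.ι ℤ (Sum.inr s))) * k (Loc.of A S s) = 1 := by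
        intro k
        refine (map_mul k _ _).symm.trans ?_
        refine (congrArg k ((map_mul (RingQuot.mkRingHom (LocRel A S)) _ _).symm.trans ((RingQuot.mkRingHom_rel (LocRel.inv_mul s)).trans (map_one _)))).trans (map_one k)
      have := h1 g
      rw [← key] at this
      exact left_inv_eq_right_inv (h2 f) this
  ext x
  exact congrArg (fun k : _ →ₐ[ℤ] B => k x) this

end Localization

/-! ### Fully invertible systems -/

/-- The finite sequences `(S₁, …, Sₙ)` with `S₁ ⊆ A`, `S₂ ⊆ A_{S₁}`, `S₃ ⊆ (A_{S₁})_{S₂}`, …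
(first component), and the iterated localization `(…((A_{S₁})_{S₂})…)_{Sₙ}` at such a sequence
(second component). -/
def Chain (A : Type u) [Ring A] : ℕ → (T : Type u) × (T → RingCat.{u})
  | 0 => ⟨PUnit, fun _ => RingCat.of A⟩
  | n + 1 => ⟨(t : (Chain A n).1) × Set ((Chain A n).2 t),
      fun p => RingCat.of (Loc ((Chain A n).2 p.1) p.2)⟩

/-- The first `n` terms `(S₁, …, Sₙ)` of the sequence which comes from `φ : A → B`, together
with the extension `φₙ : A_n → B` of `φ` to the iterated localization `A_n` at these terms:
`φ₀ = φ`, and `S_{n+1} = φₙ⁻¹(U(B))`. -/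
def chainOf {A B : Type u} [Ring A] [Ring B] (φ : A →+* B) :
    (n : ℕ) → (t : (Chain A n).1) × ((Chain A n).2 t →+* B)
  | 0 => ⟨PUnit.unit, φ⟩
  | n + 1 => ⟨⟨(chainOf φ n).1, {x | IsUnit ((chainOf φ n).2 x)}⟩,
      Loc.lift (chainOf φ n).2 fun _ hs => hs⟩

/-- The full spectrum `F(A)`: its points are the fully invertible systems on `A`, that is, the
sequences `(S₁, S₂, …)` (given by their initial segments) which come from a homomorphism from `A`
to a nonzero ring. -/
def FullSpectrum (A : Type u) [Ring A] : Type u :=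
  {s : (n : ℕ) → (Chain A n).1 //
    ∃ (B : Type u) (_ : Ring B) (_ : Nontrivial B) (φ : A →+* B), ∀ n, s n = (chainOf φ n).1}

namespace FullSpectrum

variable {A : Type u} [Ring A] (S : FullSpectrum A)

/-- The ring `A_{S,n}`. -/
def stage (n : ℕ) : RingCat.{u} := (Chain A n).2 (S.1 n)

theorem fst_succ (n : ℕ) : (S.1 (n + 1)).1 = S.1 n := by
  obtain ⟨s, B, _, _, φ, h⟩ := S
  change (s (n + 1)).1 = s n
  rw [h, h]
  rfl

/-- The localization map `A_{S,n} → A_{S,n+1} = (A_{S,n})_{S_{n+1}}`. -/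
def stageMap (n : ℕ) : S.stage n ⟶ S.stage (n + 1) :=
  eqToHom (congrArg (Chain A n).2 (S.fst_succ n).symm) ≫
    RingCat.ofHom (Loc.of ((Chain A n).2 (S.1 (n + 1)).1) (S.1 (n + 1)).2)

/-- The localization `A_S` of `A` at a fully invertible system `S`: the direct limit of the rings
`A_{S,n}`. -/
def Localized : Type u := (colimit (Functor.ofSequence S.stageMap) : RingCat.{u})

instance ringLocalized : Ring S.Localized :=
  inferInstanceAs (Ring (colimit (Functor.ofSequence S.stageMap) : RingCat.{u}))

/-- The canonical homomorphism `i_S : A → A_S`. -/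
def toLocalized : A →+* S.Localized :=
  (colimit.ι (Functor.ofSequence S.stageMap) 0).hom

end FullSpectrum

/-! ### Fractions and the topology of the full spectrum -/

/-- Fractions of `A` of length `n`: tuples `(a₁, …, aₙ)` with `a₁ ∈ A`, `a₂ ∈ A_{a₁}`,
`a₃ ∈ (A_{a₁})_{a₂}`, and so on. -/
def Fraction : ℕ → (A : Type u) → [Ring A] → Type u
  | 0, _, _ => PUnit
  | n + 1, A, _ => (a : A) × Fraction n (Loc A {a})

/-- `(a₁, …, aₙ)` is inverted by `φ : A → B`: the element `φ(a₁)` is a unit of `B`, the image of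
`a₂` under the induced homomorphism `A_{a₁} → B` is a unit of `B`, and so on. -/
def Fraction.InvertedBy {B : Type u} [Ring B] :
    (n : ℕ) → (A : Type u) → [Ring A] → Fraction n A → (A →+* B) → Prop
  | 0, _, _, _, _ => True
  | n + 1, A, _, ⟨a, t⟩, φ =>
      ∃ h : IsUnit (φ a), Fraction.InvertedBy n (Loc A {a}) t
        (Loc.lift φ fun s hs => by rw [Set.mem_singleton_iff.mp hs]; exact h)

/-- The fundamental subset `D(a) = {S ∈ F(A) | a₁, …, aₙ are invertible in A_S}`. -/
def D {A : Type u} [Ring A] {n : ℕ} (a : Fraction n A) : Set (FullSpectrum A) :=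
  {S | Fraction.InvertedBy n A a S.toLocalized}

/-- The topology generated by the fundamental subsets. -/
instance (A : Type u) [Ring A] : TopologicalSpace (FullSpectrum A) :=
  TopologicalSpace.generateFrom {V | ∃ (n : ℕ) (a : Fraction n A), V = D a}

/-! ### The structure sheaf -/

/-- Formal expressions built from elements of `A` by sums, products and formal inverses: these
are the noncommutative integral polynomials in elements `aᵢ` of `A` and in formal inverses `x_s`,
where each `s` is itself such an expression of smaller depth. -/
inductive Expr (A : Type u) : Type u
  | const (a : A) : Expr A
  | add (e f : Expr A) : Expr A
  | mul (e f : Expr A) : Expr A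
  | inv (e : Expr A) : Expr A

/-- The expression `e` is defined in `B` (via `φ`), i.e. every element that it inverts is a unit
of `B`, and it has the value `b` there. -/
def Expr.HasValue {A B : Type u} [Ring A] [Ring B] (φ : A →+* B) : Expr A → B → Prop
  | .const a, b => b = φ a
  | .add e f, b => ∃ x y, e.HasValue φ x ∧ f.HasValue φ y ∧ b = x + y
  | .mul e f, b => ∃ x y, e.HasValue φ x ∧ f.HasValue φ y ∧ b = x * y
  | .inv e, b => ∃ x, e.HasValue φ x ∧ x * b = 1 ∧ b * x = 1

variable (A : Type u) [Ring A]

/-- `F(A)` as an object of the category of topological spaces. -/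
def specTop : TopCat.{u} := TopCat.of (FullSpectrum A)

/-- The family of the rings `A_S` over `F(A)`. -/
def Fibre (S : specTop A) : Type u := FullSpectrum.Localized (A := A) S

instance (S : specTop A) : Ring (Fibre A S) :=
  FullSpectrum.ringLocalized (A := A) S

/-- The homomorphism `i_S : A → A_S`. -/
def toFibre (S : specTop A) : A →+* Fibre A S := FullSpectrum.toLocalized (A := A) S

/-- A function `S ↦ t(S) ∈ A_S` on an open set which is given by one expression. -/
def isExprPrelocal : TopCat.PrelocalPredicate (Fibre A) where
  pred {U} t := ∃ e : Expr A, ∀ S : U, e.HasValue (toFibre A S.1) (t S)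
  res := by
    rintro V U i t ⟨e, he⟩
    exact ⟨e, fun S => he (i S)⟩

/-- A function `S ↦ t(S) ∈ A_S` on an open set which is locally given by an expression. -/
def isLocallyExpr : TopCat.LocalPredicate (Fibre A) := (isExprPrelocal A).sheafify

variable {A} in
theorem isLocallyExpr_const (U : Opens (specTop A)) (a : A) :
    (isLocallyExpr A).pred (fun S : U => toFibre A S.1 a) :=
  fun S => ⟨U, S.2, 𝟙 _, .const a, fun _ => rfl⟩

/-- The ring of sections of the structure sheaf over `U`. -/
def sectionsSubring (U : Opens (specTop A)) : Subring ((S : U) → Fibre A S.1) where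
  carrier := {t | (isLocallyExpr A).pred t}
  add_mem' {a b} ha hb S := by
    obtain ⟨Va, ma, ia, ea, wa⟩ := ha S
    obtain ⟨Vb, mb, ib, eb, wb⟩ := hb S
    exact ⟨Va ⊓ Vb, ⟨ma, mb⟩, Opens.infLELeft _ _ ≫ ia, .add ea eb,
      fun T => ⟨_, _, wa ⟨T.1, T.2.1⟩, wb ⟨T.1, T.2.2⟩, rfl⟩⟩
  mul_mem' {a b} ha hb S := by
    obtain ⟨Va, ma, ia, ea, wa⟩ := ha S
    obtain ⟨Vb, mb, ib, eb, wb⟩ := hb S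
    exact ⟨Va ⊓ Vb, ⟨ma, mb⟩, Opens.infLELeft _ _ ≫ ia, .mul ea eb,
      fun T => ⟨_, _, wa ⟨T.1, T.2.1⟩, wb ⟨T.1, T.2.2⟩, rfl⟩⟩
  zero_mem' := by
    have h := isLocallyExpr_const U (0 : A)
    simp only [map_zero] at h
    exact h
  one_mem' := by
    have h := isLocallyExpr_const U (1 : A)
    simp only [map_one] at h
    exact h
  neg_mem' {a} ha S := by
    obtain ⟨Va, ma, ia, ea, wa⟩ := ha S
    refine ⟨Va, ma, ia, .mul (.const (-1)) ea, fun T => ⟨_, _, rfl, wa T, ?_⟩⟩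
    simp

/-- The structure presheaf of rings on `F(A)`. -/
def structurePresheaf : TopCat.Presheaf RingCat.{u} (specTop A) where
  obj U := RingCat.of (sectionsSubring A U.unop)
  map {U V} i := RingCat.ofHom
    { toFun := fun t => ⟨fun S => t.1 ⟨S.1, i.unop.le S.2⟩, (isLocallyExpr A).res i.unop t.1 t.2⟩
      map_one' := rfl
      map_mul' := fun _ _ => rfl
      map_zero' := rfl
      map_add' := fun _ _ => rfl }

theorem structurePresheaf_isSheaf : (structurePresheaf A).IsSheaf := by
  rw [TopCat.Presheaf.isSheaf_iff_isSheaf_comp (forget RingCat)]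
  exact TopCat.Presheaf.isSheaf_of_iso
    (NatIso.ofComponents (fun U => Iso.refl ((TopCat.subsheafToTypes (isLocallyExpr A)).1.obj U))
      (fun _ => rfl) :
      (TopCat.subsheafToTypes (isLocallyExpr A)).1 ≅ structurePresheaf A ⋙ forget RingCat)
    (TopCat.subsheafToTypes (isLocallyExpr A)).2

end FScheme

/-- A ringed space: a topological space with a sheaf of (not necessarily commutative) rings. -/
abbrev NCRingedSpace : Type (u + 1) := SheafedSpace.{u + 1, u, u} RingCat.{u}

namespace FScheme

/-- The ringed space `(F(A), 𝒪_A)`. -/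
def F (A : Type u) [Ring A] : NCRingedSpace.{u} where
  carrier := specTop A
  presheaf := structurePresheaf A
  IsSheaf := structurePresheaf_isSheaf A

/-- The open ringed subspace of `X` on an open subset `U`. -/
abbrev openSub (X : NCRingedSpace.{u}) (U : Opens X) : NCRingedSpace.{u} :=
  X.restrict U.isOpenEmbedding

/-- An affine F-scheme: a ringed space isomorphic to `F(A)` for some nonzero ring `A`. -/
def IsAffine (X : NCRingedSpace.{u}) : Prop :=
  ∃ (A : Type u) (_ : Ring A) (_ : Nontrivial A), Nonempty (X ≅ F A)

/-- An F-scheme: a ringed space which is locally isomorphic to affine F-schemes. -/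
def IsFScheme (X : NCRingedSpace.{u}) : Prop :=
  ∀ x : X, ∃ U : Opens X, x ∈ U ∧ IsAffine (openSub X U)

/-- A center of a topological space: a closed point which lies in every nonempty closed subset. -/
def IsCenter {X : Type u} [TopologicalSpace X] (x : X) : Prop :=
  IsClosed ({x} : Set X) ∧ ∀ Z : Set X, IsClosed Z → Z.Nonempty → x ∈ Z

/-- `U` is a fundamental open subset of `F(A)`. -/
def IsFundamentalOpen {A : Type u} [Ring A] (U : Set (FullSpectrum A)) : Prop :=
  ∃ (n : ℕ) (a : Fraction n A), U = D a

end FScheme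

end

noncomputable section

namespace FScheme

/-! ### Expressions and homomorphisms -/

section Expr

variable {A B C : Type u} [Ring A] [Ring B] [Ring C]

/-! A point S of F(A) is represented by homomorphisms from A to nonzero rings. Each representative φ
: A → B factors through A_S by a local homomorphism A_S → B, and conversely composing with a local
homomorphism does not change the point (`exists_local`, `ofHom_comp`). Local homomorphisms reflect
units, hence also the values of expressions and the inverting of fractions, so D(a) can be tested on
any representative (`ofHom_mem_D`). Moreover every element of A_S is the value of an expression over
A, which makes homomorphisms out of A_S unique.

If A is nonzero, its identity represents a center: a fraction inverted by the identity is inverted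
by every homomorphism, so the only open set around this point is F(A) (`FullSpectrum.isCenter`).

Let f : A → B be the iterated localization at a fraction a. Then F(B) → F(A) is an open embedding
onto D(a) with bijective maps of fibres, hence an open immersion (`Fraction.IsLoc.isOpenImmersion`),
and D(a) is affine if nonempty. Conversely, an affine open U has a center, and a fundamental open
set V ⊆ U around that center is all of U. Likewise an affine neighbourhood of a center of an
F-scheme is the whole space. Global sections never have to be computed. -/

theorem Loc.mem_of_subring {S : Set A} (R : Subring (Loc A S)) (h : ∀ a, Loc.of A S a ∈ R)
    (h' : ∀ s ∈ S, ∀ y, Loc.of A S s * y = 1 → y * Loc.of A S s = 1 → y ∈ R) (x : Loc A S) :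
    x ∈ R := by
  let φ : A →+* R := (Loc.of A S).codRestrict R h
  have hφ : ∀ s ∈ S, IsUnit (φ s) := by
    intro s hs
    obtain ⟨v, hv⟩ := Loc.isUnit_of hs
    have h1 : Loc.of A S s * (v⁻¹ : (Loc A S)ˣ) = 1 := by rw [← hv]; exact v.mul_inv
    have h2 : (v⁻¹ : (Loc A S)ˣ) * Loc.of A S s = 1 := by rw [← hv]; exact v.inv_mul
    exact ⟨⟨φ s, ⟨_, h' s hs _ h1 h2⟩, Subtype.ext h1, Subtype.ext h2⟩, rfl⟩
  -- The identity of `Loc A S` factors through `R`, by uniqueness in the universal property.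
  have key : R.subtype.comp (Loc.lift φ hφ) = RingHom.id _ := by
    apply Loc.hom_ext
    ext a
    simp only [RingHom.comp_apply, Loc.lift_of]
    rfl
  have := congrArg (fun k : Loc A S →+* Loc A S => k x) key
  simp only [RingHom.comp_apply, RingHom.id_apply] at this
  rw [← this]
  exact (Loc.lift φ hφ x).2

theorem Expr.HasValue.comp {φ : A →+* B} (h : B →+* C) {e : Expr A} {b : B}
    (H : e.HasValue φ b) : e.HasValue (h.comp φ) (h b) := by
  induction e generalizing b with
  | const a => exact congrArg h H
  | add e f he hf =>
    obtain ⟨x, y, hx, hy, rfl⟩ := H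
    exact ⟨_, _, he hx, hf hy, map_add _ _ _⟩
  | mul e f he hf =>
    obtain ⟨x, y, hx, hy, rfl⟩ := H
    exact ⟨_, _, he hx, hf hy, map_mul _ _ _⟩
  | inv e he =>
    obtain ⟨x, hx, h1, h2⟩ := H
    exact ⟨_, he hx, by rw [← map_mul, h1, map_one], by rw [← map_mul, h2, map_one]⟩

theorem Expr.HasValue.unique {φ : A →+* B} {e : Expr A} {b c : B}
    (H : e.HasValue φ b) (K : e.HasValue φ c) : b = c := by
  induction e generalizing b c with
  | const a => exact H.trans K.symm
  | add e f he hf =>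
    obtain ⟨x, y, hx, hy, rfl⟩ := H
    obtain ⟨x', y', hx', hy', rfl⟩ := K
    rw [he hx hx', hf hy hy']
  | mul e f he hf =>
    obtain ⟨x, y, hx, hy, rfl⟩ := H
    obtain ⟨x', y', hx', hy', rfl⟩ := K
    rw [he hx hx', hf hy hy']
  | inv e he =>
    obtain ⟨x, hx, h1, h2⟩ := H
    obtain ⟨x', hx', h1', h2'⟩ := K
    obtain rfl := he hx hx'
    exact left_inv_eq_right_inv h2 h1'

/-- A local homomorphism reflects the values of expressions. -/
theorem Expr.HasValue.of_comp {φ : A →+* B} (h : B →+* C) [IsLocalHom h] {e : Expr A} {c : C}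
    (H : e.HasValue (h.comp φ) c) : ∃ b, e.HasValue φ b ∧ h b = c := by
  induction e generalizing c with
  | const a => exact ⟨φ a, rfl, H.symm⟩
  | add e f he hf =>
    obtain ⟨x, y, hx, hy, rfl⟩ := H
    obtain ⟨b, hb, rfl⟩ := he hx
    obtain ⟨c, hc, rfl⟩ := hf hy
    exact ⟨b + c, ⟨_, _, hb, hc, rfl⟩, map_add _ _ _⟩
  | mul e f he hf =>
    obtain ⟨x, y, hx, hy, rfl⟩ := H
    obtain ⟨b, hb, rfl⟩ := he hx
    obtain ⟨c, hc, rfl⟩ := hf hy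
    exact ⟨b * c, ⟨_, _, hb, hc, rfl⟩, map_mul _ _ _⟩
  | inv e he =>
    obtain ⟨x, hx, h1, h2⟩ := H
    obtain ⟨b, hb, rfl⟩ := he hx
    obtain ⟨v, rfl⟩ : IsUnit b := isUnit_of_map_unit h b ⟨⟨_, _, h1, h2⟩, rfl⟩
    refine ⟨(v⁻¹ : Bˣ), ⟨_, hb, v.mul_inv, v.inv_mul⟩, ?_⟩
    refine left_inv_eq_right_inv (a := h v) ?_ h1
    rw [← map_mul, v.inv_mul, map_one]

/-- A homomorphism is rationally generated if every element of its target is the value of an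
expression over its source. -/
def RatGen (φ : A →+* B) : Prop := ∀ b, ∃ e : Expr A, e.HasValue φ b

/-- Homomorphisms preserve values of expressions and values are unique, so a rationally generated
map is an epimorphism. -/
theorem RatGen.hom_ext {φ : A →+* B} (hφ : RatGen φ) {f g : B →+* C}
    (h : f.comp φ = g.comp φ) : f = g := by
  ext b
  obtain ⟨e, he⟩ := hφ b
  have := he.comp f
  rw [h] at this
  exact this.unique (he.comp g)

/-- The substitution of expressions over `A` for the constants of an expression over `B`. -/
def Expr.bind (σ : A → Expr B) : Expr A → Expr B
  | .const a => σ a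
  | .add e f => .add (e.bind σ) (f.bind σ)
  | .mul e f => .mul (e.bind σ) (f.bind σ)
  | .inv e => .inv (e.bind σ)

theorem Expr.HasValue.bind {φ : A →+* C} {ψ : B →+* C} (σ : A → Expr B)
    (hσ : ∀ a, (σ a).HasValue ψ (φ a)) {e : Expr A} {c : C} (H : e.HasValue φ c) :
    (e.bind σ).HasValue ψ c := by
  induction e generalizing c with
  | const a =>
    obtain rfl : c = φ a := H
    exact hσ a
  | add e f he hf =>
    obtain ⟨x, y, hx, hy, rfl⟩ := H
    exact ⟨_, _, he hx, hf hy, rfl⟩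
  | mul e f he hf =>
    obtain ⟨x, y, hx, hy, rfl⟩ := H
    exact ⟨_, _, he hx, hf hy, rfl⟩
  | inv e he =>
    obtain ⟨x, hx, h⟩ := H
    exact ⟨_, he hx, h⟩

/-- The substitution is fixed before `φ`, so one `e'` serves all points of an open set at once; this
is what moves local expressions from F(B) to F(A). -/
theorem RatGen.exists_bind {f : A →+* B} (hf : RatGen f) (e : Expr B) :
    ∃ e' : Expr A, ∀ {C : Type u} [Ring C] (φ : B →+* C) (c : C), e.HasValue φ c →
      e'.HasValue (φ.comp f) c := by
  choose σ hσ using hf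
  exact ⟨e.bind σ, fun φ c h => h.bind σ fun b => (hσ b).comp φ⟩

theorem RatGen.comp {f : A →+* B} {g : B →+* C} (hg : RatGen g) (hf : RatGen f) :
    RatGen (g.comp f) := fun c => by
  obtain ⟨e, he⟩ := hg c
  obtain ⟨e', he'⟩ := hf.exists_bind e
  exact ⟨e', he' g c he⟩

theorem RatGen.id : RatGen (RingHom.id A) := fun a => ⟨.const a, rfl⟩

/-- The subring of the values of expressions. -/
def ratClosure (φ : A →+* B) : Subring B where
  carrier := {b | ∃ e : Expr A, e.HasValue φ b}
  add_mem' := fun ⟨e, he⟩ ⟨f, hf⟩ => ⟨.add e f, _, _, he, hf, rfl⟩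
  mul_mem' := fun ⟨e, he⟩ ⟨f, hf⟩ => ⟨.mul e f, _, _, he, hf, rfl⟩
  zero_mem' := ⟨.const 0, (map_zero φ).symm⟩
  one_mem' := ⟨.const 1, (map_one φ).symm⟩
  neg_mem' := fun ⟨e, he⟩ => ⟨.mul (.const (-1)) e, _, _, rfl, he, by simp⟩

theorem Loc.ratGen_of (S : Set A) : RatGen (Loc.of A S) := fun b =>
  Loc.mem_of_subring (ratClosure (Loc.of A S)) (fun a => ⟨.const a, rfl⟩)
    (fun s _ _ h1 h2 => ⟨.inv (.const s), _, rfl, h1, h2⟩) b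

theorem RatGen.surjective_of_comp {φ : A →+* B} {h : B →+* C} [IsLocalHom h]
    (H : RatGen (h.comp φ)) : Function.Surjective h := fun c => by
  obtain ⟨e, he⟩ := H c
  obtain ⟨b, _, hb⟩ := he.of_comp
  exact ⟨b, hb⟩

end Expr

/-! ### Points of the full spectrum and local homomorphisms -/

namespace FullSpectrum

variable {A B : Type u} [Ring A] [Ring B]

/-- The fully invertible system which comes from `φ`. -/
def ofHom [Nontrivial B] (φ : A →+* B) : FullSpectrum A :=
  ⟨fun n => (chainOf φ n).1, B, inferInstance, inferInstance, φ, fun _ => rfl⟩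

theorem exists_eq_ofHom (S : FullSpectrum A) :
    ∃ (B : Type u) (_ : Ring B) (_ : Nontrivial B) (φ : A →+* B), S = ofHom φ := by
  obtain ⟨s, B, i, j, φ, h⟩ := S
  exact ⟨B, i, j, φ, Subtype.ext (funext h)⟩

/-- The canonical homomorphism from the `n`-th stage to `A_S`. -/
def stageHom (S : FullSpectrum A) (n : ℕ) : S.stage n →+* S.Localized :=
  (colimit.ι (Functor.ofSequence S.stageMap) n).hom

section

variable [Nontrivial B] (φ : A →+* B)

/-- The localization map between successive stages of `ofHom φ`. -/
def ofStage (n : ℕ) : (ofHom φ).stage n →+* (ofHom φ).stage (n + 1) :=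
  Loc.of ((Chain A n).2 (chainOf φ n).1) {x | IsUnit ((chainOf φ n).2 x)}

theorem stageMap_ofHom (n : ℕ) : (ofHom φ).stageMap n = RingCat.ofHom (ofStage φ n) :=
  Category.id_comp _

theorem stageHom_ofStage (n : ℕ) (x : (ofHom φ).stage n) :
    (ofHom φ).stageHom (n + 1) (ofStage φ n x) = (ofHom φ).stageHom n x := by
  have h := colimit.w (Functor.ofSequence (ofHom φ).stageMap) (homOfLE n.le_succ)
  rw [Functor.ofSequence_map_homOfLE_succ, stageMap_ofHom] at h
  exact congrArg (fun k => k.hom x) h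

/-- The homomorphism `A_S → C` given by a compatible family of homomorphisms of the stages. -/
def desc {C : Type u} [Ring C] (g : ∀ n, (ofHom φ).stage n →+* C)
    (hg : ∀ n, (g (n + 1)).comp (ofStage φ n) = g n) : (ofHom φ).Localized →+* C :=
  (colimit.desc (Functor.ofSequence (ofHom φ).stageMap)
    { pt := RingCat.of C
      ι := NatTrans.ofSequence (fun n => RingCat.ofHom (g n)) fun n => by
        rw [Functor.ofSequence_map_homOfLE_succ, stageMap_ofHom]
        exact (congrArg RingCat.ofHom (hg n)).trans (Category.comp_id _).symm }).hom

theorem desc_stageHom {C : Type u} [Ring C] (g : ∀ n, (ofHom φ).stage n →+* C)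
    (hg : ∀ n, (g (n + 1)).comp (ofStage φ n) = g n) (n : ℕ) (x) :
    desc φ g hg ((ofHom φ).stageHom n x) = g n x := by
  have h := colimit.ι_desc (F := Functor.ofSequence (ofHom φ).stageMap)
    { pt := RingCat.of C
      ι := NatTrans.ofSequence (fun n => RingCat.ofHom (g n)) fun n => by
        rw [Functor.ofSequence_map_homOfLE_succ, stageMap_ofHom]
        exact (congrArg RingCat.ofHom (hg n)).trans (Category.comp_id _).symm } n
  exact congrArg (fun k => k.hom x) h

end

theorem localized_hom_ext (S : FullSpectrum A) {C : Type u} [Ring C] {f g : S.Localized →+* C}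
    (h : ∀ n, f.comp (S.stageHom n) = g.comp (S.stageHom n)) : f = g := by
  have : RingCat.ofHom f = RingCat.ofHom g := by
    refine colimit.hom_ext (F := Functor.ofSequence S.stageMap) fun n => ?_
    exact congrArg RingCat.ofHom (h n)
  exact congrArg RingCat.Hom.hom this

theorem stageHom_range_mono [Nontrivial B] (φ : A →+* B) :
    Monotone fun n => ((ofHom φ).stageHom n).range :=
  monotone_nat_of_le_succ fun n => by
    rintro _ ⟨x, rfl⟩
    exact ⟨_, stageHom_ofStage φ n x⟩

/-- The images of the stages form an increasing chain, so their union is a subring; the universal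
property of the colimit factors the identity through it. -/
theorem exists_stageHom_eq (S : FullSpectrum A) (x : S.Localized) :
    ∃ n y, S.stageHom n y = x := by
  obtain ⟨B, _, _, φ, rfl⟩ := S.exists_eq_ofHom
  let R : Subring (ofHom φ).Localized := ⨆ n, ((ofHom φ).stageHom n).range
  have hR : ∀ n y, (ofHom φ).stageHom n y ∈ R := fun n y =>
    le_iSup (fun n => ((ofHom φ).stageHom n).range) n ⟨y, rfl⟩
  let d := desc φ (fun n => ((ofHom φ).stageHom n).codRestrict R (hR n)) fun n => by
    ext x
    exact stageHom_ofStage φ n x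
  have key : R.subtype.comp d = RingHom.id _ := by
    refine localized_hom_ext _ fun n => ?_
    ext y
    exact congrArg Subtype.val (desc_stageHom φ _ _ n y)
  have hx : x ∈ R := by
    have := congrArg (fun k : (ofHom φ).Localized →+* (ofHom φ).Localized => k x) key
    simp only [RingHom.comp_apply, RingHom.id_apply] at this
    rw [← this]
    exact (d x).2
  rw [Subring.mem_iSup_of_directed (stageHom_range_mono φ).directed_le] at hx
  obtain ⟨n, y, hy⟩ := hx
  exact ⟨n, y, hy⟩

/-- A homomorphism `φ` extends to a local homomorphism on `A_S`, where `S` is the fully invertible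
system which comes from `φ`. -/
theorem exists_local [Nontrivial B] (φ : A →+* B) :
    ∃ h : (ofHom φ).Localized →+* B, IsLocalHom h ∧ h.comp (ofHom φ).toLocalized = φ ∧
      ∀ n, h.comp ((ofHom φ).stageHom n) = (chainOf φ n).2 := by
  have hg : ∀ n, ((chainOf φ (n + 1)).2).comp (ofStage φ n) = (chainOf φ n).2 := fun n =>
    RingHom.ext fun x => Loc.lift_of (chainOf φ n).2 (fun _ hs => hs) x
  let h := desc φ (fun n => (chainOf φ n).2) hg
  have hh : ∀ n x, h ((ofHom φ).stageHom n x) = (chainOf φ n).2 x := desc_stageHom φ _ hg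
  refine ⟨h, ⟨fun x hx => ?_⟩, RingHom.ext fun a => hh 0 a, fun n => RingHom.ext (hh n)⟩
  obtain ⟨n, y, rfl⟩ := exists_stageHom_eq _ x
  rw [hh] at hx
  -- An element of stage `n` that becomes a unit in `B` belongs to S_{n+1}, so it is inverted at
  -- stage `n + 1`.
  rw [← stageHom_ofStage]
  exact (Loc.isUnit_of (S := {x | IsUnit ((chainOf φ n).2 x)}) hx).map _

instance (S : FullSpectrum A) : Nontrivial S.Localized := by
  obtain ⟨B, _, _, φ, rfl⟩ := S.exists_eq_ofHom
  obtain ⟨h, -⟩ := exists_local φ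
  exact h.domain_nontrivial

theorem ratGen_toLocalized (S : FullSpectrum A) : RatGen S.toLocalized := by
  intro x
  obtain ⟨n, y, rfl⟩ := exists_stageHom_eq _ x
  obtain ⟨B, _, _, φ, rfl⟩ := S.exists_eq_ofHom
  induction n with
  | zero => exact ⟨.const y, rfl⟩
  | succ n ih =>
    refine Loc.mem_of_subring ((ratClosure (ofHom φ).toLocalized).comap
      ((ofHom φ).stageHom (n + 1))) (fun a => ?_) (fun s _ y h1 h2 => ?_) y
    · obtain ⟨e, he⟩ := ih a
      exact ⟨e, (stageHom_ofStage φ n a).symm ▸ he⟩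
    · obtain ⟨e, he⟩ := ih s
      refine ⟨.inv e, _, (stageHom_ofStage φ n s).symm ▸ he, ?_, ?_⟩
      · exact (map_mul _ _ _).symm.trans ((congrArg _ h1).trans (map_one _))
      · exact (map_mul _ _ _).symm.trans ((congrArg _ h2).trans (map_one _))

/-- Equality of dependent pairs: once the two localizing sets are identified, the maps are compared
on the previous stage only. -/
theorem sigma_loc_ext {n : ℕ} {t : (Chain A n).1} {U V : Set ((Chain A n).2 t)} (hUV : U = V)
    (f : Loc ((Chain A n).2 t) U →+* B) (g : Loc ((Chain A n).2 t) V →+* B)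
    (h : ∀ x, f (Loc.of _ U x) = g (Loc.of _ V x)) :
    (⟨⟨t, U⟩, f⟩ : (t : (Chain A (n + 1)).1) × ((Chain A (n + 1)).2 t →+* B)) = ⟨⟨t, V⟩, g⟩ := by
  subst hUV
  obtain rfl : f = g := Loc.hom_ext (RingHom.ext h)
  rfl

/-- A local homomorphism on `A_S` defines the fully invertible system `S`. -/
theorem ofHom_comp_toLocalized [Nontrivial B] (S : FullSpectrum A) (h : S.Localized →+* B)
    [IsLocalHom h] : ofHom (h.comp S.toLocalized) = S := by
  obtain ⟨C, _, _, ψ, rfl⟩ := S.exists_eq_ofHom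
  obtain ⟨k, hk, -, hkn⟩ := exists_local ψ
  have key : ∀ n, chainOf (h.comp (ofHom ψ).toLocalized) n =
      ⟨(chainOf ψ n).1, h.comp ((ofHom ψ).stageHom n)⟩ := by
    intro n
    induction n with
    | zero => rfl
    | succ n ih =>
      let G : ((t : (Chain A n).1) × ((Chain A n).2 t →+* B)) →
          (t : (Chain A (n + 1)).1) × ((Chain A (n + 1)).2 t →+* B) := fun p =>
        ⟨⟨p.1, {x | IsUnit (p.2 x)}⟩, Loc.lift p.2 fun _ hs => hs⟩
      -- Both `h` and `k` are local, so `x` has a unit image in the target of `h`, in A_S and in `C`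
      -- under the same condition; the next localizing sets agree.
      refine (congrArg G ih).trans (sigma_loc_ext ?_ _ _ ?_)
      · ext x
        change IsUnit (h ((ofHom ψ).stageHom n x)) ↔ IsUnit ((chainOf ψ n).2 x)
        rw [← hkn n, isUnit_map_iff h]
        exact (isUnit_map_iff k _).symm
      · intro x
        refine (Loc.lift_of _ _ _).trans ?_
        exact congrArg h (stageHom_ofStage ψ n x).symm
  exact Subtype.ext (funext fun n => congrArg Sigma.fst (key n))

theorem ofHom_toLocalized (S : FullSpectrum A) : ofHom S.toLocalized = S :=
  ofHom_comp_toLocalized S (RingHom.id _)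

/-- `φ` and its composition with a local homomorphism define the same fully invertible system. -/
theorem ofHom_comp {C : Type u} [Ring C] [Nontrivial B] [Nontrivial C] (φ : A →+* B) (h : B →+* C)
    [IsLocalHom h] : ofHom (h.comp φ) = ofHom φ := by
  obtain ⟨k, hk, hkφ, -⟩ := exists_local φ
  have : IsLocalHom (h.comp k) := RingHom.isLocalHom_comp _ _
  have := ofHom_comp_toLocalized (ofHom φ) (h.comp k)
  rwa [RingHom.comp_assoc, hkφ] at this

end FullSpectrum


/-! ### Fractions and homomorphisms -/

section Fraction

variable {A B C : Type u} [Ring A] [Ring B] [Ring C]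

theorem isUnit_singleton {φ : A →+* B} {a : A} (h : IsUnit (φ a)) :
    ∀ s ∈ ({a} : Set A), IsUnit (φ s) := fun s hs => by
  rw [Set.mem_singleton_iff.mp hs]; exact h

theorem Loc.eq_lift {S : Set A} {φ : A →+* B} (hφ : ∀ s ∈ S, IsUnit (φ s)) {g : Loc A S →+* B}
    (hg : g.comp (Loc.of A S) = φ) : g = Loc.lift φ hφ :=
  Loc.hom_ext (hg.trans (RingHom.ext fun a => (Loc.lift_of φ hφ a).symm))

theorem Loc.comp_lift {S : Set A} (φ : A →+* B) (hφ : ∀ s ∈ S, IsUnit (φ s)) (h : B →+* C) :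
    Loc.lift (h.comp φ) (fun s hs => (hφ s hs).map h) = h.comp (Loc.lift φ hφ) :=
  (Loc.eq_lift _ (RingHom.ext fun a => congrArg h (Loc.lift_of φ hφ a))).symm

theorem Fraction.InvertedBy.comp {n : ℕ} {A : Type u} [Ring A] {a : Fraction n A} {φ : A →+* B}
    (h : B →+* C) (H : InvertedBy n A a φ) : InvertedBy n A a (h.comp φ) := by
  induction n generalizing A with
  | zero => trivial
  | succ n ih =>
    obtain ⟨a, t⟩ := a
    obtain ⟨ha, ht⟩ := H
    refine ⟨ha.map h, ?_⟩
    rw [Loc.comp_lift φ (isUnit_singleton ha)]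
    exact ih ht

theorem Fraction.InvertedBy.of_comp {n : ℕ} {A : Type u} [Ring A] {a : Fraction n A} {φ : A →+* B}
    (h : B →+* C) [IsLocalHom h] (H : InvertedBy n A a (h.comp φ)) : InvertedBy n A a φ := by
  induction n generalizing A with
  | zero => trivial
  | succ n ih =>
    obtain ⟨a, t⟩ := a
    obtain ⟨ha, ht⟩ := H
    have hb : IsUnit (φ a) := isUnit_of_map_unit h _ ha
    refine ⟨hb, ih ?_⟩
    rw [Loc.comp_lift φ (isUnit_singleton hb)] at ht
    exact ht

/-- The image of a fraction under a homomorphism. -/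
theorem Fraction.exists_map {n : ℕ} {A B : Type u} [Ring A] [Ring B] (f : A →+* B)
    (a : Fraction n A) :
    ∃ b : Fraction n B, ∀ {C : Type u} [Ring C] (φ : B →+* C),
      InvertedBy n B b φ ↔ InvertedBy n A a (φ.comp f) := by
  induction n generalizing A B with
  | zero => exact ⟨PUnit.unit, fun _ => Iff.rfl⟩
  | succ n ih =>
    obtain ⟨a, t⟩ := a
    let f' : Loc A {a} →+* Loc B {f a} := Loc.lift ((Loc.of B {f a}).comp f)
      (isUnit_singleton (φ := (Loc.of B {f a}).comp f) (Loc.isUnit_of rfl))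
    obtain ⟨t', ht'⟩ := ih f' t
    refine ⟨⟨f a, t'⟩, fun {C} _ φ => exists_congr fun h => ?_⟩
    rw [ht']
    have : (Loc.lift φ (isUnit_singleton h)).comp f' =
        Loc.lift (φ.comp f) (isUnit_singleton (φ := φ.comp f) h) := by
      refine Loc.eq_lift _ (RingHom.ext fun x => ?_)
      simp [f']
    rw [this]

/-- `f : A → B` is the localization of `A` at the fraction `a`, and a fraction of `B` is given by a
longer fraction of `A`. -/
structure Fraction.IsLoc {n : ℕ} {A : Type u} [Ring A] (a : Fraction n A) (f : A →+* B) : Prop where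
  ratGen : RatGen f
  invertedBy_iff : ∀ {C : Type u} [Ring C] (φ : A →+* C),
    InvertedBy n A a φ ↔ ∃ g : B →+* C, g.comp f = φ
  exists_append : ∀ {m : ℕ} (b : Fraction m B), ∃ (k : ℕ) (c : Fraction k A),
    ∀ {C : Type u} [Ring C] (φ : A →+* C),
      InvertedBy k A c φ ↔ ∃ g : B →+* C, g.comp f = φ ∧ InvertedBy m B b g

/-- `B` is the last ring of the tower A → A_{a₁} → (A_{a₁})_{a₂} → …. Fractions recurse from the
front, so appending `b` to the tail and then prepending the first entry gives the longer fraction.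
-/
theorem Fraction.exists_isLoc {n : ℕ} {A : Type u} [Ring A] (a : Fraction n A) :
    ∃ (B : Type u) (_ : Ring B) (f : A →+* B), a.IsLoc f := by
  induction n generalizing A with
  | zero =>
    refine ⟨A, inferInstance, RingHom.id A, RatGen.id,
      fun φ => iff_of_true trivial ⟨φ, φ.comp_id⟩,
      fun {m} b => ⟨m, b, fun φ => ⟨fun h => ⟨φ, φ.comp_id, h⟩, ?_⟩⟩⟩
    rintro ⟨g, rfl, h⟩
    exact h
  | succ n ih =>
    obtain ⟨a, t⟩ := a
    obtain ⟨B, _, f, hf⟩ := ih t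
    -- The predicate `P` is kept free: it is `True` for the mapping property and the inverting of
    -- `b` for appended fractions.
    have key : ∀ {C : Type u} [Ring C] (φ : A →+* C) (P : (B →+* C) → Prop),
        (∃ h : IsUnit (φ a), ∃ g : B →+* C, g.comp f = Loc.lift φ (isUnit_singleton h) ∧ P g) ↔
          ∃ g : B →+* C, g.comp (f.comp (Loc.of A {a})) = φ ∧ P g := by
      intro C _ φ P
      constructor
      · rintro ⟨h, g, hg, hP⟩
        refine ⟨g, ?_, hP⟩
        rw [← RingHom.comp_assoc, hg]
        exact RingHom.ext fun x => Loc.lift_of _ _ _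
      · rintro ⟨g, rfl, hP⟩
        refine ⟨(Loc.isUnit_of (S := {a}) rfl).map (g.comp f), g, Loc.eq_lift _ rfl, hP⟩
    refine ⟨B, inferInstance, f.comp (Loc.of A {a}), hf.ratGen.comp (Loc.ratGen_of _), ?_, ?_⟩
    · intro C _ φ
      have := key φ fun _ => True
      simp only [and_true] at this
      rw [← this]
      exact exists_congr fun h => hf.invertedBy_iff _
    · intro m b
      obtain ⟨k, c, hc⟩ := hf.exists_append b
      refine ⟨k + 1, ⟨a, c⟩, fun φ => ?_⟩
      rw [← key φ fun g => InvertedBy m B b g]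
      exact exists_congr fun h => hc _

end Fraction

/-! ### The topology of the full spectrum -/

section Topology

variable {A B : Type u} [Ring A] [Ring B]

open FullSpectrum

theorem ofHom_mem_D [Nontrivial B] {n : ℕ} {a : Fraction n A} {φ : A →+* B} :
    ofHom φ ∈ D a ↔ a.InvertedBy n A φ := by
  obtain ⟨h, hl, hφ, -⟩ := exists_local φ
  refine ⟨fun H => ?_, fun H => ?_⟩
  · rw [← hφ]
    exact Fraction.InvertedBy.comp h H
  · rw [← hφ] at H
    exact H.of_comp h

theorem isOpen_D {n : ℕ} (a : Fraction n A) : IsOpen (D a) := isOpen_generateFrom_of_mem ⟨n, a, rfl⟩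

/-- Push `b` forward to the localization at `a`, then append the result to `a`. -/
theorem exists_D_eq_inter {n m : ℕ} (a : Fraction n A) (b : Fraction m A) :
    ∃ (k : ℕ) (c : Fraction k A), D c = D a ∩ D b := by
  obtain ⟨B, _, f, hf⟩ := a.exists_isLoc
  obtain ⟨b', hb'⟩ := b.exists_map f
  obtain ⟨k, c, hc⟩ := hf.exists_append b'
  refine ⟨k, c, Set.ext fun S => (hc _).trans ⟨?_, ?_⟩⟩
  · rintro ⟨g, hg, h⟩
    rw [hb', hg] at h
    exact ⟨(hf.invertedBy_iff _).mpr ⟨g, hg⟩, h⟩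
  · rintro ⟨h1, h2⟩
    obtain ⟨g, hg⟩ := (hf.invertedBy_iff _).mp h1
    refine ⟨g, hg, ?_⟩
    rw [hb', hg]
    exact h2

theorem isTopologicalBasis_D :
    IsTopologicalBasis {V : Set (FullSpectrum A) | IsFundamentalOpen V} where
  exists_subset_inter := by
    rintro _ ⟨n, a, rfl⟩ _ ⟨m, b, rfl⟩ S hS
    obtain ⟨k, c, hc⟩ := exists_D_eq_inter a b
    exact ⟨D c, ⟨k, c, rfl⟩, hc ▸ hS, hc.subset⟩
  sUnion_eq := Set.eq_univ_of_forall fun S =>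
    ⟨D (A := A) (n := 0) PUnit.unit, ⟨0, _, rfl⟩, trivial⟩
  eq_generateFrom := rfl

theorem FullSpectrum.eq_univ_of_isOpen [Nontrivial A] {U : Set (FullSpectrum A)} (hU : IsOpen U)
    (h : ofHom (RingHom.id A) ∈ U) : U = Set.univ := by
  obtain ⟨_, ⟨n, a, rfl⟩, ha, haU⟩ := isTopologicalBasis_D.exists_subset_of_mem_open h hU
  refine Set.eq_univ_of_forall fun S => haU ?_
  exact (ofHom_mem_D.mp ha).comp S.toLocalized

theorem FullSpectrum.isCenter [Nontrivial A] : IsCenter (ofHom (RingHom.id A)) := by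
  constructor
  · rw [← isOpen_compl_iff, isTopologicalBasis_D.isOpen_iff]
    intro S hS
    -- If `S.toLocalized` were local, it would represent the same point as the identity. Hence some
    -- nonunit of `A` becomes a unit in A_S, and its D separates `S` from the center.
    have : ¬ IsLocalHom S.toLocalized := fun h => hS <| by
      have := ofHom_comp (RingHom.id A) S.toLocalized
      rw [RingHom.comp_id, ofHom_toLocalized] at this
      exact this
    have : ∃ a, IsUnit (S.toLocalized a) ∧ ¬ IsUnit a := by
      by_contra! H
      exact this ⟨H⟩
    obtain ⟨a, ha, ha'⟩ := this
    refine ⟨D (n := 1) ⟨a, PUnit.unit⟩, ⟨1, _, rfl⟩, ⟨ha, trivial⟩, ?_⟩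
    rintro _ h rfl
    exact ha' (ofHom_mem_D.mp h).1
  · intro Z hZ hne
    by_contra h
    have := FullSpectrum.eq_univ_of_isOpen hZ.isOpen_compl h
    rw [Set.compl_univ_iff] at this
    exact hne.ne_empty this

theorem IsCenter.eq_univ {X : Type u} [TopologicalSpace X] {x : X} (hx : IsCenter x) {U : Set X}
    (hU : IsOpen U) (hxU : x ∈ U) : U = Set.univ := by
  by_contra h
  exact hx.2 Uᶜ hU.isClosed_compl (Set.nonempty_compl.mpr h) hxU

theorem IsCenter.map {X Y : Type u} [TopologicalSpace X] [TopologicalSpace Y] {x : X}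
    (hx : IsCenter x) (f : X ≃ₜ Y) : IsCenter (f x) := by
  constructor
  · have := f.isClosedMap _ hx.1
    rwa [Set.image_singleton] at this
  · intro Z hZ hne
    exact hx.2 (f ⁻¹' Z) (hZ.preimage f.continuous) (hne.preimage f.surjective)

end Topology

/-! ### Functoriality -/

section Comap

open FullSpectrum

variable {A B : Type u} [Ring A] [Ring B]

/-- The map `F(B) → F(A)` induced by `f : A → B`. -/
def FullSpectrum.comap (f : A →+* B) (T : FullSpectrum B) : FullSpectrum A :=
  ofHom (T.toLocalized.comp f)

theorem FullSpectrum.continuous_comap (f : A →+* B) : Continuous (comap f) := by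
  refine continuous_generateFrom_iff.mpr ?_
  rintro _ ⟨n, a, rfl⟩
  obtain ⟨b, hb⟩ := a.exists_map f
  convert isOpen_D b using 1
  ext T
  exact ofHom_mem_D.trans (hb _).symm

/-- The local homomorphism on the localizations induced by `f`. -/
def FullSpectrum.localizedMap (f : A →+* B) (T : FullSpectrum B) :
    (comap f T).Localized →+* T.Localized :=
  (exists_local (T.toLocalized.comp f)).choose

instance (f : A →+* B) (T : FullSpectrum B) : IsLocalHom (localizedMap f T) :=
  (exists_local (T.toLocalized.comp f)).choose_spec.1

theorem FullSpectrum.localizedMap_comp (f : A →+* B) (T : FullSpectrum B) :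
    (localizedMap f T).comp (comap f T).toLocalized = T.toLocalized.comp f :=
  (exists_local (T.toLocalized.comp f)).choose_spec.2.1

theorem FullSpectrum.comap_ofHom {C : Type u} [Ring C] [Nontrivial C] (f : A →+* B)
    (g : B →+* C) : comap f (ofHom g) = ofHom (g.comp f) := by
  obtain ⟨h, hl, hg, -⟩ := exists_local g
  have := ofHom_comp ((ofHom g).toLocalized.comp f) h
  rw [← RingHom.comp_assoc, hg] at this
  exact this.symm

theorem FullSpectrum.exists_local_of_eq {S : FullSpectrum A} [Nontrivial B] {φ : A →+* B}
    (h : ofHom φ = S) :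
    ∃ h : S.Localized →+* B, IsLocalHom h ∧ h.comp S.toLocalized = φ := by
  subst h
  obtain ⟨h, h1, h2, -⟩ := exists_local φ
  exact ⟨h, h1, h2⟩

/-- By rational generation, `g` followed by the local map A_S → B_T is the canonical map of `T`, so
`g` represents `T`. Thus `T` is recovered from its image in F(A). -/
theorem RatGen.ofHom_eq {f : A →+* B} (hf : RatGen f) {S : FullSpectrum A} {T : FullSpectrum B}
    (h : comap f T = S) {g : B →+* S.Localized} (hg : g.comp f = S.toLocalized) :
    ofHom g = T := by
  subst h
  have : (localizedMap f T).comp g = T.toLocalized := by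
    apply hf.hom_ext
    rw [RingHom.comp_assoc, hg, localizedMap_comp]
  rw [← ofHom_comp g (localizedMap f T), this, ofHom_toLocalized]

namespace Fraction.IsLoc

variable {n : ℕ} {a : Fraction n A} {f : A →+* B} (hf : a.IsLoc f)

include hf

theorem range_comap : Set.range (comap f) = D a := by
  refine Set.Subset.antisymm ?_ fun S hS => ?_
  · rintro _ ⟨T, rfl⟩
    exact ofHom_mem_D.mpr ((hf.invertedBy_iff _).mpr ⟨_, rfl⟩)
  · obtain ⟨g, hg⟩ := (hf.invertedBy_iff _).mp hS
    exact ⟨ofHom g, by rw [comap_ofHom, hg, ofHom_toLocalized]⟩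

theorem exists_hom (T : FullSpectrum B) :
    ∃ g : B →+* (comap f T).Localized, g.comp f = (comap f T).toLocalized :=
  (hf.invertedBy_iff _).mp (hf.range_comap.subset ⟨T, rfl⟩)

theorem comap_injective : Function.Injective (comap f) := fun T T' h => by
  obtain ⟨g, hg⟩ := hf.exists_hom T
  rw [← hf.ratGen.ofHom_eq rfl hg, ← hf.ratGen.ofHom_eq h.symm hg]

/-- The image of D(b) is D(c), where `c` is the fraction obtained by appending `b` to `a`. -/
theorem isOpenMap_comap : IsOpenMap (comap f) := by
  refine isTopologicalBasis_D.isOpenMap_iff.mpr ?_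
  rintro _ ⟨m, b, rfl⟩
  obtain ⟨k, c, hc⟩ := hf.exists_append b
  convert isOpen_D c using 1
  ext S
  refine Iff.trans ⟨?_, ?_⟩ (hc _).symm
  · rintro ⟨T, hT, rfl⟩
    exact (hc _).mp (ofHom_mem_D.mpr ((hc _).mpr ⟨_, rfl, hT⟩))
  · rintro ⟨g, hg, h⟩
    exact ⟨ofHom g, ofHom_mem_D.mpr h, by rw [comap_ofHom, hg, ofHom_toLocalized]⟩

theorem isOpenEmbedding_comap : Topology.IsOpenEmbedding (comap f) :=
  .of_continuous_injective_isOpenMap (continuous_comap f) hf.comap_injective hf.isOpenMap_comap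

/-- Injectivity: the factorization `g` of A → A_S through `B` represents `T`, so it extends to B_T,
and this extension is a left inverse since both sides agree on `A`. Surjectivity: the map is local
and B_T is rationally generated over `A`. -/
theorem localizedMap_bijective (T : FullSpectrum B) : Function.Bijective (localizedMap f T) := by
  constructor
  · obtain ⟨g, hg⟩ := hf.exists_hom T
    obtain ⟨h, -, hT⟩ := exists_local_of_eq (hf.ratGen.ofHom_eq rfl hg)
    have : h.comp (localizedMap f T) = RingHom.id _ := by
      apply (ratGen_toLocalized _).hom_ext
      rw [RingHom.comp_assoc, localizedMap_comp, ← RingHom.comp_assoc, hT, hg, RingHom.id_comp]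
    exact Function.LeftInverse.injective (g := h) fun x =>
      congrArg (fun k : (comap f T).Localized →+* (comap f T).Localized => k x) this
  · refine RatGen.surjective_of_comp (φ := (comap f T).toLocalized) ?_
    rw [localizedMap_comp]
    exact (ratGen_toLocalized T).comp hf.ratGen

end Fraction.IsLoc

end Comap


/-! ### Open immersions of affine F-schemes -/

section OpenImmersion

open FullSpectrum

variable {A B : Type u} [Ring A] [Ring B]

/-- The continuous map `F(B) → F(A)` induced by `f : A → B`. -/
def specMap (f : A →+* B) : specTop B ⟶ specTop A :=
  TopCat.ofHom ⟨comap f, continuous_comap f⟩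

/-- The homomorphism of fibres over a point `T` of `F(B)` induced by `f`. -/
def fibreMap (f : A →+* B) (T : specTop B) : Fibre A (specMap f T) →+* Fibre B T :=
  localizedMap f T

theorem Expr.HasValue.fibreMap (f : A →+* B) {T : specTop B} {e : Expr A} {x : Fibre A (specMap f T)}
    (h : e.HasValue (toFibre A (specMap f T)) x) :
    (e.bind fun a => .const (f a)).HasValue (toFibre B T) (fibreMap f T x) := by
  refine Expr.HasValue.bind (φ := (toFibre B T).comp f)
    (fun a => .const (f a)) (fun a => rfl) ?_
  have : (FScheme.fibreMap f T).comp (toFibre A (specMap f T)) = (toFibre B T).comp f :=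
    localizedMap_comp f T
  rw [← this]
  exact h.comp (FScheme.fibreMap f T)

/-- The pullback of sections of the structure sheaf along `F(B) → F(A)`. -/
def sectionsComap (f : A →+* B) (U : Opens (specTop A)) :
    sectionsSubring A U →+* sectionsSubring B ((Opens.map (specMap f)).obj U) where
  toFun t := ⟨fun T => fibreMap f T.1 (t.1 ⟨specMap f T.1, T.2⟩), fun T => by
    obtain ⟨V, hV, i, e, he⟩ := t.2 ⟨specMap f T.1, T.2⟩
    exact ⟨(Opens.map (specMap f)).obj V, hV, homOfLE fun x hx => i.le hx,
      e.bind fun a => .const (f a), fun T' => Expr.HasValue.fibreMap f (he ⟨specMap f T'.1, T'.2⟩)⟩⟩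
  map_one' := Subtype.ext (funext fun T => map_one (fibreMap f T.1))
  map_mul' _ _ := Subtype.ext (funext fun T => map_mul (fibreMap f T.1) _ _)
  map_zero' := Subtype.ext (funext fun T => map_zero (fibreMap f T.1))
  map_add' _ _ := Subtype.ext (funext fun T => map_add (fibreMap f T.1) _ _)

/-- The morphism `F(B) → F(A)` of ringed spaces induced by `f : A → B`. -/
def spaceMap (f : A →+* B) : (F B).toPresheafedSpace ⟶ (F A).toPresheafedSpace where
  base := specMap f
  c := { app := fun U => RingCat.ofHom (sectionsComap f U.unop) }

theorem Fraction.IsLoc.sectionsComap_bijective {n : ℕ} {a : Fraction n A} {f : A →+* B}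
    (hf : a.IsLoc f) {U : Opens (specTop A)} (hU : (U : Set (specTop A)) ⊆ D a) :
    Function.Bijective (sectionsComap f U) := by
  constructor
  · intro t t' h
    refine Subtype.ext (funext fun S => ?_)
    obtain ⟨S, hS⟩ := S
    obtain ⟨T, rfl⟩ := hf.range_comap.superset (hU hS)
    exact (hf.localizedMap_bijective T).1 (congrFun (congrArg Subtype.val h) ⟨T, hS⟩)
  · intro s
    -- Quantifying over every preimage `T` of `S` lets the chosen values be used later at `comap f
    -- T` with the equality `rfl`.
    have key : ∀ S : U, ∃ x : Fibre A S.1, ∀ (T : FullSpectrum B) (h : comap f T = S.1),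
        localizedMap f T (h ▸ x) = s.1 ⟨T, show comap f T ∈ U from h ▸ S.2⟩ := by
      rintro ⟨S, hS⟩
      obtain ⟨T, rfl⟩ := hf.range_comap.superset (hU hS)
      obtain ⟨x, hx⟩ := (hf.localizedMap_bijective T).2 (s.1 ⟨T, hS⟩)
      refine ⟨x, fun T' h => ?_⟩
      obtain rfl := hf.comap_injective h
      exact hx
    choose t ht using key
    have ht' : ∀ (T : FullSpectrum B) (hT : comap f T ∈ U),
        localizedMap f T (t ⟨comap f T, hT⟩) = s.1 ⟨T, hT⟩ := fun T hT => ht ⟨_, hT⟩ T rfl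
    refine ⟨⟨t, ?_⟩, Subtype.ext (funext fun T => ht' T.1 T.2)⟩
    rintro ⟨S, hS⟩
    obtain ⟨T, rfl⟩ := hf.range_comap.superset (hU hS)
    obtain ⟨V, hV, i, e, he⟩ := s.2 ⟨T, hS⟩
    obtain ⟨e', he'⟩ := hf.ratGen.exists_bind e
    refine ⟨⟨comap f '' (V : Set (specTop B)), hf.isOpenMap_comap _ V.2⟩, ⟨T, hV, rfl⟩,
      homOfLE ?_, e', ?_⟩
    · rintro _ ⟨T', hT', rfl⟩
      exact i.le hT'
    · rintro ⟨_, T', hT', rfl⟩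
      -- The expression over `A` has its value in B_T; the local map of fibres lifts the value to
      -- A_S, and injectivity identifies the lift with `t`.
      have := he' _ _ (he ⟨T', hT'⟩)
      change Expr.HasValue (T'.toLocalized.comp f) e' (s.1 ⟨T', i.le hT'⟩) at this
      rw [← localizedMap_comp, ← ht' T' (i.le hT')] at this
      obtain ⟨b, hb, hb'⟩ := this.of_comp
      obtain rfl := (hf.localizedMap_bijective T').1 hb'
      exact hb

theorem Fraction.IsLoc.isOpenImmersion {n : ℕ} {a : Fraction n A} {f : A →+* B}
    (hf : a.IsLoc f) : PresheafedSpace.IsOpenImmersion (spaceMap f) where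
  base_open := hf.isOpenEmbedding_comap
  c_iso U := by
    rw [ConcreteCategory.isIso_iff_bijective]
    refine hf.sectionsComap_bijective ?_
    rintro _ ⟨T, -, rfl⟩
    exact hf.range_comap.subset ⟨T, rfl⟩

end OpenImmersion

/-! ### Open affine subspaces -/

section Main

open FullSpectrum

/-- The homeomorphism underlying an isomorphism of ringed spaces. -/
def homeo {X Y : NCRingedSpace.{u}} (e : X ≅ Y) : X ≃ₜ Y :=
  TopCat.homeoOfIso ((SheafedSpace.forget RingCat.{u}).mapIso e)

/-- Open immersions into the same space with equal ranges have isomorphic sources. -/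
theorem isAffine_of_isOpenImmersion {A : Type u} [Ring A] [Nontrivial A] {X Y : NCRingedSpace.{u}}
    {f : X.toPresheafedSpace ⟶ Y.toPresheafedSpace} (hf : PresheafedSpace.IsOpenImmersion f)
    {g : (F A).toPresheafedSpace ⟶ Y.toPresheafedSpace} (hg : PresheafedSpace.IsOpenImmersion g)
    (h : Set.range f.base = Set.range g.base) : IsAffine X :=
  ⟨A, inferInstance, inferInstance,
    ⟨SheafedSpace.isoMk (PresheafedSpace.IsOpenImmersion.isoOfRangeEq f g h)⟩⟩

theorem IsAffine.exists_isCenter {X : NCRingedSpace.{u}} (hX : IsAffine X) :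
    ∃ x : X, IsCenter x := by
  obtain ⟨A, _, _, ⟨e⟩⟩ := hX
  exact ⟨_, IsCenter.map (FullSpectrum.isCenter (A := A)) (homeo e).symm⟩

/-- The isomorphism of presheafed spaces underlying an isomorphism of ringed spaces. -/
def presheafedIso {X Y : NCRingedSpace.{u}} (e : X ≅ Y) :
    X.toPresheafedSpace ≅ Y.toPresheafedSpace :=
  SheafedSpace.forgetToPresheafedSpace.mapIso e

theorem isAffine_of_openSub_top {X : NCRingedSpace.{u}} (h : IsAffine (openSub X ⊤)) :
    IsAffine X := by
  obtain ⟨A, _, _, ⟨e⟩⟩ := h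
  have h1 := PresheafedSpace.IsOpenImmersion.ofIso (presheafedIso e.symm)
  have h2 := PresheafedSpace.IsOpenImmersion.ofRestrict X.toPresheafedSpace
    (⊤ : Opens X).isOpenEmbedding
  have h3 := PresheafedSpace.IsOpenImmersion.comp (presheafedIso e.symm).hom (hg := h2)
  refine isAffine_of_isOpenImmersion
    (PresheafedSpace.IsOpenImmersion.ofIso (Iso.refl X.toPresheafedSpace)) h3
    (Set.range_id.trans (Eq.symm ?_))
  refine Set.eq_univ_of_forall fun x => ⟨homeo e ⟨x, trivial⟩, ?_⟩
  exact congrArg Subtype.val ((homeo e).symm_apply_apply ⟨x, trivial⟩)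

theorem isAffine_openSub {X : NCRingedSpace.{u}} {A : Type u} [Ring A]
    (e : X ≅ F A) {U : Opens X} (hne : (U : Set X).Nonempty) {n : ℕ} (a : Fraction n A)
    (hU : (U : Set X) = e.hom.hom.base ⁻¹' D a) : IsAffine (openSub X U) := by
  obtain ⟨B, _, f, hf⟩ := a.exists_isLoc
  have hr := hf.range_comap
  -- A point of `U` yields a point of F(B), whose localization is a nonzero ring receiving a map
  -- from `B`.
  have : Nontrivial B := by
    obtain ⟨x, hx⟩ := hne
    rw [hU] at hx
    obtain ⟨T, -⟩ := hr.superset hx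
    exact T.toLocalized.domain_nontrivial
  have h1 := PresheafedSpace.IsOpenImmersion.ofIso (presheafedIso e)
  have h2 := PresheafedSpace.IsOpenImmersion.ofRestrict X.toPresheafedSpace U.isOpenEmbedding
  have h3 := PresheafedSpace.IsOpenImmersion.comp (X.toPresheafedSpace.ofRestrict U.isOpenEmbedding)
    (presheafedIso e).hom
  refine isAffine_of_isOpenImmersion (X := openSub X U) (Y := F A) h3 hf.isOpenImmersion ?_
  refine Eq.trans ?_ hr.symm
  ext S
  constructor
  · rintro ⟨x, rfl⟩
    exact hU.subset x.2
  · intro hS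
    have hx : homeo e ((homeo e).symm S) = S := (homeo e).apply_symm_apply S
    refine ⟨⟨(homeo e).symm S, hU.superset ?_⟩, hx⟩
    change homeo e ((homeo e).symm S) ∈ D a
    rw [hx]
    exact hS

theorem isFundamentalOpen_of_isAffine {X : NCRingedSpace.{u}} {A : Type u} [Ring A]
    (e : X ≅ F A) {U : Opens X} (h : IsAffine (openSub X U)) : (U : Set X).Nonempty ∧
      ∃ V : Set (FullSpectrum A), IsFundamentalOpen V ∧ (U : Set X) = e.hom.hom.base ⁻¹' V := by
  obtain ⟨x, hx⟩ := h.exists_isCenter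
  change (U : Type u) at x
  have hopen : IsOpen ((homeo e).symm ⁻¹' (U : Set X)) := U.isOpen.preimage (homeo e).symm.continuous
  have hx' : homeo e x.1 ∈ (homeo e).symm ⁻¹' (U : Set X) := by
    change (homeo e).symm (homeo e x.1) ∈ (U : Set X)
    rw [(homeo e).symm_apply_apply]
    exact x.2
  obtain ⟨V, hV, hxV, hVU⟩ := isTopologicalBasis_D.exists_subset_of_mem_open hx' hopen
  refine ⟨⟨x.1, x.2⟩, V, hV, ?_⟩
  have hVo : IsOpen V := isTopologicalBasis_D.isOpen hV
  -- The trace of `V` on `U` is open and contains the center of `U`.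
  have hW : (fun y : U => homeo e y.1) ⁻¹' V = Set.univ :=
    IsCenter.eq_univ hx (hVo.preimage ((homeo e).continuous.comp continuous_subtype_val)) hxV
  refine Set.Subset.antisymm (fun y hy => hW.superset (Set.mem_univ (⟨y, hy⟩ : U))) fun y hy => ?_
  have := hVU hy
  change (homeo e).symm (homeo e y) ∈ (U : Set X) at this
  rwa [(homeo e).symm_apply_apply] at this

end Main

end FScheme

end

theorem mainTheorem7 :
    (∀ X : NCRingedSpace.{u}, FScheme.IsFScheme X →
      (FScheme.IsAffine X ↔ ∃ x : X, FScheme.IsCenter x)) ∧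
    (∀ (X : NCRingedSpace.{u}) (A : Type u) [Ring A] [Nontrivial A] (e : X ≅ FScheme.F A)
      (U : Opens X),
      FScheme.IsAffine (FScheme.openSub X U) ↔
        (U : Set X).Nonempty ∧
          ∃ V : Set (FScheme.FullSpectrum A), FScheme.IsFundamentalOpen V ∧
            (U : Set X) = e.hom.hom.base ⁻¹' V) := by
  constructor
  · intro X hX
    refine ⟨fun h => h.exists_isCenter, ?_⟩
    rintro ⟨x, hx⟩
    obtain ⟨U, hxU, hU⟩ := hX x
    -- The complement of `U` is closed and misses the center, hence is empty.
    obtain rfl : U = ⊤ := Opens.ext (hx.eq_univ U.isOpen hxU)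
    exact FScheme.isAffine_of_openSub_top hU
  · intro X A _ _ e U
    refine ⟨FScheme.isFundamentalOpen_of_isAffine e, ?_⟩
    rintro ⟨hne, _, ⟨n, a, rfl⟩, h⟩
    exact FScheme.isAffine_openSub e hne a h
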